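/- Let $\mathcal{A}$ be a finite set of action symbols, let $\tau\notin\mathcal{A}$, and put $\mathcal{A}_\tau=\mathcal{A}\cup\{\tau\}$. A *transition system* $T=(S,\to,\uparrow,\downarrow)$ consists of a set of states $S$, a relation $\to\subseteq S\times\mathcal{A}_\tau\times S$, an initial state $\uparrow\in S$ and a set of final states $\downarrow\subseteq S$. It is *deterministic* if $s\xrightarrow{a}s_1$ and $s\xrightarrow{a}s_2$ imply $s_1=s_2$ for all $a\in\mathcal{A}_\tau$, and $s\xrightarrow{\tau}s_1$ implies that $s$ has no outgoing $a$-transition with $a\neq\tau$. It is *computable* if every set $\mathit{out}(s)=\{(a,t)\mid s\xrightarrow{a}t\}$ is finite and there are injections $\mathcal{A}_\tau\to\mathbb{N}$ and $S\to\mathbb{N}$ (codings), the latter written $s\mapsto\ulcorner s\urcorner$, such that the partial functions on $\mathbb{N}$ that map $\ulcorner s\urcorner$ to the code of the finite set $\mathit{out}(s)$ (using the standard codings of pairs and of finite sets of natural numbers) and to the value at $s$ of the characteristic function of $\downarrow$, respectively, and that are undefined on all numbers that are not codes of states, are partial recursive. A *reactive Turing machine* (RTM) over a finite set $\mathcal{D}$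 of data symbols, with $\mathcal{D}_\square=\mathcal{D}\cup\{\square\}$ where $\square\notin\mathcal{D}$ is the blank, consists of a finite set of states $Q$, a transition relation $\to\subseteq Q\times\mathcal{D}_\square\times\mathcal{A}_\tau\times\mathcal{D}_\square\times\{L,R\}\times Q$, an initial state and a set of final states. A transition $(s,d,a,e,M,t)$ means: in state $s$, reading $d$, execute $a$, write $e$, move the head one cell in direction $M$, and go to state $t$. The RTM is *deterministic* if $(s,d,a,e_1,M_1,t_1),(s,d,a,e_2,M_2,t_2)\in{\to}$ implies $e_1=e_2$, $M_1=M_2$, $t_1=t_2$, and $(s,d,\tau,e_1,M_1,t_1)\in{\to}$ implies that there is no $(s,d,a,e_2,M_2,t_2)\in{\to}$ with $a\neq\tau$. Its transition system $\mathcal{T}(M)$ has as states the pairs of a state in $Q$ and a two-way infinite tape with a head position and only finitely many non-blank cells (considered up to translation), has the transitions induced by the transition relation, starts in the initial state with an empty tape, and has as final states the configurations whose state is final. A *branching bisimulation* from $T_1$ to $T_2$ is a relation $R\subseteq S_1\times S_2$ such that $s_1\mathrel{R}s_2$ implies: 1. if $s_1\xrightarrow{a}s_1'$, then there are $s_2'',s_2'$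 with $s_2\xrightarrow{\tau}{}^{*}s_2''$, $s_1\mathrel{R}s_2''$, $s_1'\mathrel{R}s_2'$, and either $s_2''\xrightarrow{a}s_2'$, or $a=\tau$ and $s_2''=s_2'$; 2. if $s_1$ is final, then there is a final $s_2'$ with $s_2\xrightarrow{\tau}{}^{*}s_2'$ and $s_1\mathrel{R}s_2'$; 3. the symmetric versions of 1 and 2, with the roles of $T_1$ and $T_2$ exchanged. It is *divergence-preserving* if moreover, whenever $s_1\mathrel{R}s_2$ and there is an infinite sequence $s_1=s_{1,0}\xrightarrow{\tau}s_{1,1}\xrightarrow{\tau}\cdots$ with $s_{1,i}\mathrel{R}s_2$ for all $i$, there are $s_2'$ and $i$ with $s_2\xrightarrow{\tau}{}^{+}s_2'$ and $s_{1,i}\mathrel{R}s_2'$; and symmetrically. Two transition systems are *divergence-preserving branching bisimilar* if some divergence-preserving branching bisimulation from the first to the second relates their initial states. **Corollary.** For every deterministic computable transition system $T$ over $\mathcal{A}_\tau$ there exist a finite set of data symbols and a deterministic RTM $M$ over it, with action symbols $\mathcal{A}$, such that $\mathcal{T}(M)$ and $T$ are divergence-preserving branching bisimilar. -/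

import Mathlib

universe u v w

/-- The actions in `Act` together with the unobservable action `τ`: `none` is `τ`,
and `some a` is the observable action `a`. -/
abbrev ActTau (Act : Type u) : Type u := Option Act

/-- The unobservable action. -/
abbrev tau {Act : Type u} : ActTau Act := none

/-! ### Labelled transition systems -/

/-- A transition system labelled with `Act ∪ {τ}`. -/
structure TransitionSystem (Act : Type u) where
  State : Type v
  step : State → ActTau Act → State → Prop
  init : State
  final : Set State

namespace TransitionSystem

variable {Act : Type u}

/-- The set of outgoing transitions of a state. -/
def out (T : TransitionSystem.{u, v} Act) (s : T.State) : Set (ActTau Act × T.State) :=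
  {p | T.step s p.1 p.2}

def FinitelyBranching (T : TransitionSystem.{u, v} Act) : Prop :=
  ∀ s, (T.out s).Finite

def Deterministic (T : TransitionSystem.{u, v} Act) : Prop :=
  (∀ s a s₁ s₂, T.step s a s₁ → T.step s a s₂ → s₁ = s₂) ∧
  (∀ s s₁, T.step s tau s₁ → ¬ ∃ a s₂, a ≠ tau ∧ T.step s a s₂)

/-- The relation `s ⟶τ t`. -/
def tauStep (T : TransitionSystem.{u, v} Act) (s t : T.State) : Prop :=
  T.step s tau t

/-- The reflexive-transitive closure of `⟶τ`. -/
def tauSteps (T : TransitionSystem.{u, v} Act) : T.State → T.State → Prop :=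
  Relation.ReflTransGen T.tauStep

/-- The transitive closure of `⟶τ`. -/
def tauStepsPlus (T : TransitionSystem.{u, v} Act) : T.State → T.State → Prop :=
  Relation.TransGen T.tauStep

/-- The relation `s ⟶(a) t`: an `a`-step, or no step at all if `a = τ`. -/
def optStep (T : TransitionSystem.{u, v} Act) (s : T.State) (a : ActTau Act)
    (t : T.State) : Prop :=
  T.step s a t ∨ (a = tau ∧ s = t)

end TransitionSystem

/-! ### Branching bisimilarity -/

section Bisimulation

variable {Act : Type u}

structure IsBranchingBisimulation (T₁ : TransitionSystem.{u, v} Act)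
    (T₂ : TransitionSystem.{u, w} Act) (R : T₁.State → T₂.State → Prop) : Prop where
  forth : ∀ s₁ s₂, R s₁ s₂ → ∀ a s₁', T₁.step s₁ a s₁' →
    ∃ s₂'' s₂', T₂.tauSteps s₂ s₂'' ∧ T₂.optStep s₂'' a s₂' ∧ R s₁ s₂'' ∧ R s₁' s₂'
  back : ∀ s₁ s₂, R s₁ s₂ → ∀ a s₂', T₂.step s₂ a s₂' →
    ∃ s₁'' s₁', T₁.tauSteps s₁ s₁'' ∧ T₁.optStep s₁'' a s₁' ∧ R s₁'' s₂ ∧ R s₁' s₂'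
  final_forth : ∀ s₁ s₂, R s₁ s₂ → s₁ ∈ T₁.final →
    ∃ s₂', T₂.tauSteps s₂ s₂' ∧ R s₁ s₂' ∧ s₂' ∈ T₂.final
  final_back : ∀ s₁ s₂, R s₁ s₂ → s₂ ∈ T₂.final →
    ∃ s₁', T₁.tauSteps s₁ s₁' ∧ R s₁' s₂ ∧ s₁' ∈ T₁.final

structure IsDivergencePreserving (T₁ : TransitionSystem.{u, v} Act)
    (T₂ : TransitionSystem.{u, w} Act) (R : T₁.State → T₂.State → Prop) : Prop where
  forth : ∀ s₁ s₂, R s₁ s₂ → ∀ σ : ℕ → T₁.State, σ 0 = s₁ →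
    (∀ i, T₁.tauStep (σ i) (σ (i + 1))) → (∀ i, R (σ i) s₂) →
    ∃ s₂', T₂.tauStepsPlus s₂ s₂' ∧ ∃ i, R (σ i) s₂'
  back : ∀ s₁ s₂, R s₁ s₂ → ∀ σ : ℕ → T₂.State, σ 0 = s₂ →
    (∀ i, T₂.tauStep (σ i) (σ (i + 1))) → (∀ i, R s₁ (σ i)) →
    ∃ s₁', T₁.tauStepsPlus s₁ s₁' ∧ ∃ i, R s₁' (σ i)

/-- Divergence-preserving branching bisimilarity of transition systems. -/
def DivPresBranchingBisimilar (T₁ : TransitionSystem.{u, v} Act)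
    (T₂ : TransitionSystem.{u, w} Act) : Prop :=
  ∃ R : T₁.State → T₂.State → Prop,
    IsBranchingBisimulation T₁ T₂ R ∧ IsDivergencePreserving T₁ T₂ R ∧ R T₁.init T₂.init

end Bisimulation

/-! ### Computable transition systems -/

/-- The canonical index `2 ^ x₁ + ⋯ + 2 ^ xₖ` of a finite set `{x₁, …, xₖ}` of natural numbers. -/
noncomputable def finiteSetCode (X : Set ℕ) (hX : X.Finite) : ℕ :=
  ∑ x ∈ hX.toFinset, 2 ^ x

/-- `f : S → ℕ` is recursive with respect to the coding `code` of `S`: the partial function on `ℕ`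
that maps `code s` to `f s` for every `s`, and is undefined on all numbers that are not codes, is
partial recursive. -/
def RecursiveUnderCoding {S : Type v} (code : S → ℕ) (f : S → ℕ) : Prop :=
  ∃ g : ℕ →. ℕ, Nat.Partrec g ∧ (∀ s, g (code s) = Part.some (f s)) ∧
    ∀ n, n ∉ Set.range code → g n = Part.none

namespace TransitionSystem

variable {Act : Type u}

/-- The code of the finite set `out s`, given codings of actions and of states. -/
noncomputable def outCode (T : TransitionSystem.{u, v} Act) (hT : T.FinitelyBranching)
    (codeAct : ActTau Act → ℕ) (codeState : T.State → ℕ) (s : T.State) : ℕ :=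
  finiteSetCode ((fun p => Nat.pair (codeAct p.1) (codeState p.2)) '' T.out s) ((hT s).image _)

open Classical in
/-- The characteristic function of the set of final states. -/
noncomputable def fin (T : TransitionSystem.{u, v} Act) (s : T.State) : ℕ :=
  if s ∈ T.final then 1 else 0

/-- A finitely branching transition system is computable if, for some codings (injections into `ℕ`)
of its actions and of its states, `out` and `fin` are recursive functions. -/
def IsComputable (T : TransitionSystem.{u, v} Act) : Prop :=
  ∃ hT : T.FinitelyBranching,
    ∃ (codeAct : ActTau Act → ℕ) (codeState : T.State → ℕ),
      Function.Injective codeAct ∧ Function.Injective codeState ∧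
      RecursiveUnderCoding codeState (T.outCode hT codeAct codeState) ∧
      RecursiveUnderCoding codeState T.fin

end TransitionSystem

/-! ### Reactive Turing machines -/

/-- The data symbols together with the blank: `none` is the blank, which is also the `default`
element, i.e. the blank of Mathlib tapes over `TapeSymbol Data`. -/
abbrev TapeSymbol (Data : Type w) : Type w := Option Data

/-- A reactive Turing machine with action symbols `Act` and data symbols `Data`.
`trans s d a e M t` says that in state `s`, reading `d`, the machine may execute the action `a`,
write `e`, move the head in direction `M`, and go to state `t`. -/
structure RTM (Act : Type u) (Data : Type w) where
  State : Type v
  finite_state : Finite State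
  trans : State → TapeSymbol Data → ActTau Act → TapeSymbol Data → Turing.Dir → State → Prop
  init : State
  final : Set State

namespace RTM

variable {Act : Type u} {Data : Type w}

def Deterministic (M : RTM.{u, v, w} Act Data) : Prop :=
  (∀ s d a e₁ e₂ M₁ M₂ t₁ t₂, M.trans s d a e₁ M₁ t₁ → M.trans s d a e₂ M₂ t₂ →
    e₁ = e₂ ∧ t₁ = t₂ ∧ M₁ = M₂) ∧
  (∀ s d e₁ M₁ t₁, M.trans s d tau e₁ M₁ t₁ →
    ¬ ∃ a e₂ M₂ t₂, a ≠ tau ∧ M.trans s d a e₂ M₂ t₂)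

/-- Configurations: a state and a tape instance. A `Turing.Tape` is a two-way infinite tape with a
marked head cell and finitely many non-blank cells, i.e. a finite sequence of tape symbols with one
marked symbol, up to adding or removing blanks at its two ends. -/
abbrev Config (M : RTM.{u, v, w} Act Data) : Type (max v w) :=
  M.State × Turing.Tape (TapeSymbol Data)

/-- The transition system associated with a reactive Turing machine. Its initial configuration has
an empty tape; a configuration is final if its state is. -/
def lts (M : RTM.{u, v, w} Act Data) : TransitionSystem.{u, max v w} Act where
  State := M.Config
  step c a c' := ∃ e dir, M.trans c.1 c.2.head a e dir c'.1 ∧ c'.2 = (c.2.write e).move dir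
  init := (M.init, default)
  final := {c | c.1 ∈ M.final}

end RTM

/-! The machine keeps the code of the current state `s` of `T` on its tape. By silent steps it
computes whether `s` is final and which of the finitely many actions are enabled, collecting the
answers as a Boolean vector in its finite control. Only then does it enter a `ready` control state,
which is final iff `s` is and offers exactly the actions enabled in `s`. Executing one of them
starts the computation of the code of the successor, which is unique because `T` is deterministic.

A configuration is related to `s` when it leads silently, out of non-final configurations only, to a
ready configuration for `s`. The machine is deterministic, so these steps resolve no choice and are
inert. Each such phase is finite, so a divergence of the machine must pass through a ready
configuration and take a τ-step of `T` there. `DivPresBranchingBisimilar.of_silentReach` isolates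
this argument.

The evaluators come from the compilation of partial recursive functions to Turing machines, cut down
to finitely many labels (`exists_postMachine`). `RTM.ofOptMove` replaces steps that leave the head
in place by two moves, and `exists_rtm_of_codes` assembles the pieces. -/

open Turing

/-! ### Evaluating partial recursive functions by finite tape machines -/

/-- The effect of a Post-Turing statement on a tape. -/
def Turing.TM0.Stmt.apply {Γ : Type*} [Inhabited Γ] : TM0.Stmt Γ → Tape Γ → Tape Γ
  | .move d, t => t.move d
  | .write a, t => t.write a

/-- One step of a Post-Turing machine given by its transition function. -/
def PostStep {Γ Λ : Type*} [Inhabited Γ] (δ : Λ → Γ → Option (Λ × TM0.Stmt Γ))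
    (c c' : Λ × Tape Γ) : Prop :=
  ∃ s, δ c.1 c.2.head = some (c'.1, s) ∧ c'.2 = s.apply c.2

/-- The tape alphabet of the single-tape simulation of the four-stack machine that evaluates
`Turing.ToPartrec.Code`. -/
abbrev StackSymbol : Type := TM2to1.Γ' PartrecToTM2.K' fun _ => PartrecToTM2.Γ'

/-- The tape `t` stores the list `v` on the main stack; the other stacks are empty. -/
def StoresList (v : List ℕ) (t : Tape StackSymbol) : Prop :=
  ∃ L : ListBlank (∀ _ : PartrecToTM2.K', Option PartrecToTM2.Γ'),
    (∀ k, L.map (proj k) =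
      ListBlank.mk ((PartrecToTM2.K'.elim (PartrecToTM2.trList v) [] [] [] k).map some).reverse) ∧
    t = Tape.mk' ∅ (TM2to1.addBottom L)

/-- The chain of compilations from `TM2` through `TM1` to `TM0` preserves evaluation, and each stage
has a finite support closed under steps. Restricting the labels to the last support `S` makes the
machine finite without changing its runs from the start label. The halting tape again has the stored
form, so evaluations can be chained. -/
theorem exists_postMachine (c : ToPartrec.Code) :
    ∃ (Λ : Type) (_ : Finite Λ) (start : Λ)
      (δ : Λ → StackSymbol → Option (Λ × TM0.Stmt StackSymbol)),
      ∀ v w t, StoresList v t → w ∈ c.eval v → ∃ l t', StoresList w t' ∧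
        Relation.ReflTransGen (PostStep δ) (start, t) (l, t') ∧ δ l t'.head = none := by
  classical
  let i₂ : Inhabited PartrecToTM2.Λ' :=
    ⟨PartrecToTM2.trNormal c PartrecToTM2.Cont'.halt⟩
  have h₂ := PartrecToTM2.tr_supports c PartrecToTM2.Cont'.halt
  have h₁ := TM2to1.tr_supports PartrecToTM2.tr h₂
  have h₀ := TM1to0.tr_supports (TM2to1.tr PartrecToTM2.tr) h₁
  let M := TM1to0.tr (TM2to1.tr PartrecToTM2.tr)
  let S := TM1to0.trStmts (TM2to1.tr PartrecToTM2.tr)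
    (TM2to1.trSupp PartrecToTM2.tr (PartrecToTM2.codeSupp c PartrecToTM2.Cont'.halt))
  let δ : S → StackSymbol → Option (S × TM0.Stmt StackSymbol) := fun q a =>
    (M q.1 a).pmap (fun p hp => (⟨p.1, hp⟩, p.2))
      (fun p hp => h₀.2 (q' := p.1) (s := p.2) hp q.2)
  refine ⟨S, inferInstance, ⟨default, h₀.1⟩, δ, ?_⟩
  rintro v w t ⟨L, hL, rfl⟩ hw
  have e₂ : PartrecToTM2.halt w ∈
      StateTransition.eval (TM2.step PartrecToTM2.tr) (PartrecToTM2.init c v) := by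
    rw [PartrecToTM2.tr_eval]
    exact Part.mem_map _ hw
  obtain ⟨b₁, hb₁, e₁⟩ := StateTransition.tr_eval (TM2to1.tr_respects PartrecToTM2.tr)
    (TM2to1.TrCfg.mk (q := _) (v := _) L hL) e₂
  obtain ⟨b₀, hb₀, e₀⟩ := StateTransition.tr_eval
    (TM1to0.tr_respects (TM2to1.tr PartrecToTM2.tr)) rfl e₁
  subst hb₀
  obtain ⟨e₀, hn⟩ := StateTransition.mem_eval.1 e₀
  have key : ∀ a b : TM0.Cfg StackSymbol (TM1to0.Λ' (TM2to1.tr PartrecToTM2.tr)),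
      StateTransition.Reaches (TM0.step M) a b → ∀ ha : a.q ∈ S, ∃ hb : b.q ∈ S,
        Relation.ReflTransGen (PostStep δ) (⟨a.q, ha⟩, a.Tape) (⟨b.q, hb⟩, b.Tape) := by
    intro a b hab ha
    induction hab with
    | refl => exact ⟨ha, .refl⟩
    | @tail b d _ hbd ih =>
      obtain ⟨hb, ih⟩ := ih
      obtain ⟨⟨q', s⟩, hq, rfl⟩ := Option.map_eq_some_iff.1 hbd
      have hq' : M b.q b.Tape.head = some (q', s) := hq
      refine ⟨h₀.2 hq hb, ih.tail ⟨s, ?_, ?_⟩⟩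
      · simp [δ, hq']
      · cases s <;> rfl
  obtain ⟨hb, hr⟩ := key _ _ e₀ h₀.1
  cases hb₁ with
  | mk L' hL' =>
    refine ⟨⟨_, hb⟩, _, ⟨L', hL', rfl⟩, hr, ?_⟩
    simp [δ, M, TM1to0.trCfg, TM1to0.tr]

instance : Finite PartrecToTM2.K' :=
  Finite.of_injective (β := Fin 4)
    (fun k => match k with | .main => 0 | .rev => 1 | .aux => 2 | .stack => 3)
    (by intro a b; cases a <;> cases b <;> simp)

instance : Finite StackSymbol :=
  inferInstanceAs (Finite (Bool × (PartrecToTM2.K' → Option PartrecToTM2.Γ')))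

/-- The bottom marker together with empty stacks. -/
def emptyStackSymbol : StackSymbol := (true, fun _ => none)

theorem storesList_nil : StoresList [] ((default : Tape StackSymbol).write emptyStackSymbol) := by
  refine ⟨default, fun k => ?_, ?_⟩
  · cases k <;> rfl
  · rfl

/-- Whether the second symbol from the bottom of the main stack is a one, as seen when the head is
on the cell next to the bottom. -/
def flag (a : StackSymbol) : Prop := a.2 .main = some .bit1

/-- Stacks lie bottom first, so the head is on the `cons` that ends the list. The cell to its right
holds the single digit of `b` if `b = 1`, and the `cons` that ends `m` if `b = 0`. One move thus
reveals the answer, whatever the length of `m`. -/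
theorem flag_of_storesList {m b : ℕ} {t : Tape StackSymbol} (h : StoresList [m, b] t)
    (hb : b = 0 ∨ b = 1) : flag (t.move .right).head ↔ b = 1 := by
  obtain ⟨L, hL, rfl⟩ := h
  have h1 : (Tape.move .right (Tape.mk' ∅ (TM2to1.addBottom L))).head.2 PartrecToTM2.K'.main =
      L.nth 1 PartrecToTM2.K'.main := by
    rw [← TM2to1.addBottom_nth_snd, Tape.move_right_mk', Tape.mk'_head, ListBlank.nth_succ,
      ListBlank.nth_zero]
  unfold flag
  rw [h1, TM2to1.stk_nth_val _ (hL _)]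
  rcases hb with rfl | rfl
  · simp
  · have : PartrecToTM2.trNat 1 = [.bit1] := rfl
    simp [this]

/-! ### Bisimilarity by silent deterministic computation phases -/

section SilentPhases

variable {Act : Type u}

/-- A silent step out of a state that is not final. -/
def TransitionSystem.SilentStep (T : TransitionSystem.{u, v} Act) (c c' : T.State) : Prop :=
  c ∉ T.final ∧ T.step c tau c'

/-- `c` reaches `c'` by silent steps out of states that are not final. -/
def TransitionSystem.SilentReach (T : TransitionSystem.{u, v} Act) :
    T.State → T.State → Prop :=
  Relation.ReflTransGen T.SilentStep

theorem TransitionSystem.SilentReach.tauSteps {T : TransitionSystem.{u, v} Act} {c c' : T.State}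
    (h : T.SilentReach c c') : T.tauSteps c c' :=
  Relation.ReflTransGen.mono (r := T.SilentStep) (p := T.tauStep) (fun _ _ h => h.2) _ _ h

/-- Let `T₁` be deterministic, and let `D` relate some of its states to states of `T₂` such that
related states agree on finality and on the enabled actions, and such that every transition out of
a state related by `D` leads to a state from which a state related by `D` to the corresponding
target is reached silently. Then `T₁` and `T₂` are divergence-preserving branching bisimilar. -/
theorem DivPresBranchingBisimilar.of_silentReach
    (T₁ : TransitionSystem.{u, v} Act) (T₂ : TransitionSystem.{u, w} Act)
    (hdet : T₁.Deterministic) (D : T₁.State → T₂.State → Prop)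
    (hinit : ∃ d, T₁.SilentReach T₁.init d ∧ D d T₂.init)
    (hfinal : ∀ d s, D d s → (d ∈ T₁.final ↔ s ∈ T₂.final))
    (hforth : ∀ d s, D d s → ∀ a c, T₁.step d a c →
      ∃ t, T₂.step s a t ∧ ∃ d', T₁.SilentReach c d' ∧ D d' t)
    (hback : ∀ d s, D d s → ∀ a t, T₂.step s a t →
      ∃ c, T₁.step d a c ∧ ∃ d', T₁.SilentReach c d' ∧ D d' t) :
    DivPresBranchingBisimilar T₁ T₂ := by
  let R : T₁.State → T₂.State → Prop := fun c s => ∃ d, T₁.SilentReach c d ∧ D d s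
  refine ⟨R, ⟨?_, ?_, ?_, ?_⟩, ⟨?_, ?_⟩, hinit⟩
  · rintro c s ⟨d, hcd, hD⟩ a c' hstep
    rcases Relation.ReflTransGen.cases_head hcd with rfl | ⟨c₁, h₁, h₂⟩
    · obtain ⟨t, ht, hR⟩ := hforth _ _ hD _ _ hstep
      exact ⟨s, t, .refl, .inl ht, ⟨_, .refl, hD⟩, hR⟩
    -- Before `d` is reached, the silent step is the only one available, so it is matched by no step
    -- of `T₂`.
    · have ha : a = tau := by
        by_contra ha
        exact hdet.2 _ _ h₁.2 ⟨a, c', ha, hstep⟩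
      subst ha
      obtain rfl := hdet.1 _ _ _ _ hstep h₁.2
      exact ⟨s, s, .refl, .inr ⟨rfl, rfl⟩, ⟨d, hcd, hD⟩, ⟨d, h₂, hD⟩⟩
  · rintro c s ⟨d, hcd, hD⟩ a t hstep
    obtain ⟨c', hc', hR⟩ := hback _ _ hD _ _ hstep
    exact ⟨d, c', hcd.tauSteps, .inl hc', ⟨d, .refl, hD⟩, hR⟩
  · rintro c s ⟨d, hcd, hD⟩ hc
    rcases Relation.ReflTransGen.cases_head hcd with rfl | ⟨c₁, h₁, -⟩
    · exact ⟨s, .refl, ⟨_, .refl, hD⟩, (hfinal _ _ hD).1 hc⟩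
    · exact absurd hc h₁.1
  · rintro c s ⟨d, hcd, hD⟩ hs
    exact ⟨d, hcd.tauSteps, ⟨d, .refl, hD⟩, (hfinal _ _ hD).2 hs⟩
  · rintro c s ⟨d, hcd, hD⟩ σ rfl hσ hR
    -- Determinism forces the divergence `σ` along the silent path to `d`; its step out of `d` is
    -- then a genuine step of `T₂`.
    have key : ∀ c, T₁.SilentReach c d → ∀ i, σ i = c → ∃ j, σ j = d := by
      intro c hc
      induction hc using Relation.ReflTransGen.head_induction_on with
      | refl => exact fun i hi => ⟨i, hi⟩
      | head h₁ _ ih =>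
        intro i hi
        refine ih (i + 1) (hdet.1 _ _ _ _ (hσ i) ?_)
        rw [hi]
        exact h₁.2
    obtain ⟨j, rfl⟩ := key _ hcd 0 rfl
    obtain ⟨t, ht, hR'⟩ := hforth _ _ hD _ _ (hσ j)
    exact ⟨t, .single ht, j + 1, hR'⟩
  · rintro c s ⟨d, hcd, hD⟩ σ rfl hσ hR
    obtain ⟨c', hc', hR'⟩ := hback _ _ hD _ _ (hσ 0)
    exact ⟨c', Relation.TransGen.tail' hcd.tauSteps hc', 1, hR'⟩

end SilentPhases

/-- The transition system of a deterministic machine is deterministic. -/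
theorem RTM.Deterministic.lts {Act : Type u} {Data : Type w} {M : RTM.{u, v, w} Act Data}
    (h : M.Deterministic) : M.lts.Deterministic := by
  refine ⟨?_, ?_⟩
  · rintro s a s₁ s₂ ⟨e₁, d₁, h₁, t₁⟩ ⟨e₂, d₂, h₂, t₂⟩
    obtain ⟨rfl, hs, rfl⟩ := h.1 _ _ _ _ _ _ _ _ _ h₁ h₂
    exact Prod.ext hs (t₁.trans t₂.symm)
  · rintro s s₁ ⟨e₁, d₁, h₁, -⟩ ⟨a, s₂, ha, e₂, d₂, h₂, -⟩
    exact h.2 _ _ _ _ _ h₁ ⟨a, e₂, d₂, _, ha, h₂⟩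

/-! ### Machines that may keep the head in place -/

section StayMachine

variable {Act : Type u} {Γ S : Type} [Inhabited Γ]

/-- Identify the additional blank with the default symbol. -/
def forgetBlank (Γ : Type) [Inhabited Γ] : PointedMap (Option Γ) Γ :=
  ⟨fun a => a.getD default, rfl⟩

/-- Move the head, or keep it in place. -/
def Turing.Tape.optMove (t : Tape Γ) : Option Dir → Tape Γ
  | none => t
  | some d => t.move d

/-- The reactive Turing machine of a transition function whose moves are optional: a step without a
move is executed as a move to the right followed by a silent move to the left, and the second
component of the state indicates whether that move to the left is pending. -/
def RTM.ofOptMove [Finite S] (δ : S → Γ → ActTau Act → Option (Γ × Option Dir × S)) (init : S)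
    (final : Set S) : RTM.{u, 0, 0} Act Γ where
  State := S × Bool
  finite_state := inferInstance
  trans s d a e m t :=
    (s.2 = false ∧ ∃ b o, δ s.1 (d.getD default) a = some (b, o, t.1) ∧ e = some b ∧
      m = o.getD .right ∧ t.2 = o.isNone) ∨
    (s.2 = true ∧ a = tau ∧ e = d ∧ m = .left ∧ t = (s.1, false))
  init := (init, false)
  final := {s | s.2 = false ∧ s.1 ∈ final}

variable [Finite S] {δ : S → Γ → ActTau Act → Option (Γ × Option Dir × S)} {init : S}
  {final : Set S}

theorem RTM.ofOptMove_deterministic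
    (h : ∀ s b a, a ≠ tau → (δ s b tau).isSome → δ s b a = none) :
    (RTM.ofOptMove δ init final).Deterministic := by
  refine ⟨?_, ?_⟩
  · rintro ⟨s, _⟩ d a e₁ e₂ M₁ M₂ ⟨t₁, x₁⟩ ⟨t₂, x₂⟩
      (⟨rfl, b₁, o₁, h₁, rfl, rfl, rfl⟩ | ⟨rfl, rfl, rfl, rfl, k₁⟩)
      (⟨hs, b₂, o₂, h₂, rfl, rfl, rfl⟩ | ⟨hs, -, rfl, rfl, k₂⟩)
    · rw [h₁] at h₂
      cases h₂
      exact ⟨rfl, rfl, rfl⟩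
    · cases hs
    · cases hs
    · exact ⟨rfl, k₁.trans k₂.symm, rfl⟩
  · rintro ⟨s, _⟩ d e₁ M₁ ⟨t₁, x₁⟩
      (⟨rfl, b₁, o₁, h₁, -⟩ | ⟨rfl, -⟩)
      ⟨a, e₂, M₂, ⟨t₂, x₂⟩, ha, (⟨hs, b₂, o₂, h₂, -⟩ | ⟨hs, ha', -⟩)⟩
    · rw [h _ _ _ ha (by rw [h₁]; rfl)] at h₂
      cases h₂
    · exact ha ha'
    · cases hs
    · exact ha ha'

/-- The configuration `c` is in state `s` with tape `t`, and no move is pending. -/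
def RTM.OptMoveAt (c : (RTM.ofOptMove δ init final).Config) (s : S) (t : Tape Γ) : Prop :=
  c.1 = (s, false) ∧ c.2.map (forgetBlank Γ) = t

theorem RTM.OptMoveAt.mem_final {c : (RTM.ofOptMove δ init final).Config} {s : S} {t : Tape Γ}
    (h : RTM.OptMoveAt c s t) : c ∈ (RTM.ofOptMove δ init final).lts.final ↔ s ∈ final := by
  obtain ⟨_, t⟩ := c
  obtain ⟨rfl, -⟩ := h
  exact ⟨fun h => h.2, fun h => ⟨rfl, h⟩⟩

/-- Enabledness suffices here: in a deterministic machine the step itself is then the one given by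
`RTM.OptMoveAt.exists_step`. -/
theorem RTM.OptMoveAt.isSome_of_step {c c' : (RTM.ofOptMove δ init final).Config} {s : S}
    {t : Tape Γ} {a : ActTau Act} (h : RTM.OptMoveAt c s t)
    (hc : (RTM.ofOptMove δ init final).lts.step c a c') : (δ s t.head a).isSome := by
  obtain ⟨_, t⟩ := c
  obtain ⟨rfl, rfl⟩ := h
  obtain ⟨e, m, ⟨-, b, o, h, -⟩ | ⟨hs, -⟩, -⟩ := hc
  · rw [Tape.map_fst]
    exact Option.isSome_iff_exists.2 ⟨_, h⟩
  · cases hs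

/-- The action is executed together with the first move. If a move back is pending, it is a silent
step out of a non-final configuration and rewrites the scanned symbol, so it is absorbed into
`SilentReach`. -/
theorem RTM.OptMoveAt.exists_step {c : (RTM.ofOptMove δ init final).Config} {s s' : S}
    {t : Tape Γ} {a : ActTau Act} {b : Γ} {o : Option Dir} (h : RTM.OptMoveAt c s t)
    (hδ : δ s t.head a = some (b, o, s')) :
    ∃ c', (RTM.ofOptMove δ init final).lts.step c a c' ∧
      ∃ c'', (RTM.ofOptMove δ init final).lts.SilentReach c' c'' ∧
        RTM.OptMoveAt c'' s' ((t.write b).optMove o) := by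
  obtain ⟨_, t⟩ := c
  obtain ⟨rfl, rfl⟩ := h
  rw [Tape.map_fst] at hδ
  have hw : (t.write (some b)).map (forgetBlank Γ) = (t.map (forgetBlank Γ)).write b :=
    Tape.map_write _ _ _
  refine ⟨((s', o.isNone), (t.write (some b)).move (o.getD .right)),
    ⟨some b, _, .inl ⟨rfl, b, o, hδ, rfl, rfl, rfl⟩, rfl⟩, ?_⟩
  cases o with
  | none =>
    refine ⟨((s', false), t.write (some b)), .single ⟨?_, ?_⟩, rfl, ?_⟩
    · rintro ⟨h, -⟩
      cases h
    · refine ⟨_, .left, .inr ⟨rfl, rfl, rfl, rfl, rfl⟩, ?_⟩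
      simp [Tape.write_self]
    · exact hw
  | some d =>
    refine ⟨_, .refl, rfl, ?_⟩
    exact (Tape.map_move _ _ _).trans (by rw [hw]; rfl)

theorem RTM.OptMoveAt.silentReach {c : (RTM.ofOptMove δ init final).Config} {s s' : S}
    {t : Tape Γ} {b : Γ} {o : Option Dir} (h : RTM.OptMoveAt c s t) (hs : s ∉ final)
    (hδ : δ s t.head tau = some (b, o, s')) :
    ∃ c', (RTM.ofOptMove δ init final).lts.SilentReach c c' ∧
        RTM.OptMoveAt c' s' ((t.write b).optMove o) := by
  obtain ⟨c', h₁, c'', h₂, h₃⟩ := h.exists_step hδ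
  exact ⟨c'', Relation.ReflTransGen.head ⟨fun hc => hs (h.mem_final.1 hc), h₁⟩ h₂, h₃⟩

end StayMachine

/-! ### Reactive programs over lists of natural numbers -/

section ReactiveProgram

/-- A program that alternates between evaluating partial recursive functions on a stored list of
natural numbers and offering actions. After the evaluation at a query state the program branches on
whether the stored list is of the form `[m, 1]` or `[m, 0]`. -/
structure ReactiveProgram (Act : Type u) where
  Query : Type
  Ready : Type
  finite_query : Finite Query
  finite_ready : Finite Ready
  code : Query → ToPartrec.Code
  next : Query → Bool → Query ⊕ Ready
  start : Query
  react : Ready → ActTau Act → Option Query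
  final : Set Ready
  deterministic : ∀ e a, a ≠ tau → (react e tau).isSome → react e a = none

namespace ReactiveProgram

variable {Act : Type u} (P : ReactiveProgram Act)

instance : Finite P.Query := P.finite_query

instance : Finite P.Ready := P.finite_ready

/-- The labels of the machine evaluating the code of a query state. -/
def Label (p : P.Query) : Type := (exists_postMachine (P.code p)).choose

instance (p : P.Query) : Finite (P.Label p) := (exists_postMachine (P.code p)).choose_spec.choose

noncomputable def startLabel (p : P.Query) : P.Label p :=
  (exists_postMachine (P.code p)).choose_spec.choose_spec.choose

noncomputable def postTrans (p : P.Query) :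
    P.Label p → StackSymbol → Option (P.Label p × TM0.Stmt StackSymbol) :=
  (exists_postMachine (P.code p)).choose_spec.choose_spec.choose_spec.choose

theorem postTrans_spec (p : P.Query) : ∀ v w t, StoresList v t → w ∈ (P.code p).eval v →
    ∃ l t', StoresList w t' ∧
      Relation.ReflTransGen (PostStep (P.postTrans p)) (P.startLabel p, t) (l, t') ∧
      P.postTrans p l t'.head = none :=
  (exists_postMachine (P.code p)).choose_spec.choose_spec.choose_spec.choose_spec

/-- The control states of the machine executing a program. -/
inductive Control
  | boot : Control
  | run (p : P.Query) (l : P.Label p) : Control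
  | read (p : P.Query) : Control
  | ready (e : P.Ready) : Control

instance : Finite P.Control :=
  Finite.of_injective (β := Option ((Σ p, P.Label p) ⊕ P.Query ⊕ P.Ready))
    (fun c => match c with
      | .boot => none
      | .run p l => some (.inl ⟨p, l⟩)
      | .read p => some (.inr (.inl p))
      | .ready e => some (.inr (.inr e)))
    (by
      intro a b
      cases a <;> cases b <;> simp)

variable {P} in
/-- The control state in which the execution of a state of the program starts. -/
noncomputable def entry : P.Query ⊕ P.Ready → P.Control
  | .inl p => .run p (P.startLabel p)
  | .inr e => .ready e

open Classical in
/-- The transition function of the machine executing a program. -/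
noncomputable def trans :
    P.Control → StackSymbol → ActTau Act → Option (StackSymbol × Option Dir × P.Control)
  | .boot, _, none => some (emptyStackSymbol, none, entry (.inl P.start))
  | .run p l, b, none =>
    match P.postTrans p l b with
    | none => some (b, some .right, .read p)
    | some (l', .move d) => some (b, some d, .run p l')
    | some (l', .write b') => some (b', none, .run p l')
  | .read p, b, none => some (b, some .left, entry (P.next p (decide (flag b))))
  | .ready e, b, a => (P.react e a).map fun p => (b, none, entry (.inl p))
  | _, _, some _ => none

/-- The reactive Turing machine executing a program. -/
noncomputable def machine : RTM.{u, 0, 0} Act StackSymbol :=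
  RTM.ofOptMove P.trans .boot (Control.ready '' P.final)

theorem machine_deterministic : P.machine.Deterministic := by
  refine RTM.ofOptMove_deterministic ?_
  rintro s b a ha h
  obtain ⟨a, rfl⟩ := Option.ne_none_iff_exists'.1 ha
  cases s with
  | ready e =>
    simp only [trans, Option.isSome_map, Option.map_eq_none_iff] at h ⊢
    exact P.deterministic e _ ha h
  | _ => rfl

/-- The configuration `c` is about to execute the state `q` of the program with stored list `v`. -/
def At (q : P.Query ⊕ P.Ready) (v : List ℕ) (c : P.machine.lts.State) : Prop :=
  ∃ t, StoresList v t ∧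
    RTM.OptMoveAt (δ := P.trans) (init := .boot) (final := Control.ready '' P.final) c (entry q) t

variable {P}

theorem exists_silentReach_init :
    ∃ c, P.machine.lts.SilentReach P.machine.lts.init c ∧ P.At (.inl P.start) [] c := by
  have h : RTM.OptMoveAt (δ := P.trans) (init := .boot) (final := Control.ready '' P.final)
      (RTM.lts _).init .boot default := ⟨rfl, rfl⟩
  obtain ⟨c, h₁, h₂⟩ := h.silentReach (by simp) rfl
  exact ⟨c, h₁, _, storesList_nil, h₂⟩

-- Only `ready` control states are final, so the run of the evaluator, the excursion to the flag
-- cell and the return all consist of silent steps out of non-final configurations.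
open Classical in
theorem At.exists_silentReach {p : P.Query} {v : List ℕ} {c : P.machine.lts.State} {m b : ℕ}
    (h : P.At (.inl p) v c) (hw : [m, b] ∈ (P.code p).eval v) (hb : b = 0 ∨ b = 1) :
    ∃ c', P.machine.lts.SilentReach c c' ∧ P.At (P.next p (decide (b = 1))) [m, b] c' := by
  obtain ⟨t, ht, hc⟩ := h
  obtain ⟨l, t', ht', hr, hl⟩ := P.postTrans_spec p _ _ _ ht hw
  have key : ∀ x, Relation.ReflTransGen (PostStep (P.postTrans p)) (P.startLabel p, t) x →
      ∃ c', P.machine.lts.SilentReach c c' ∧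
        RTM.OptMoveAt (δ := P.trans) (init := .boot) (final := Control.ready '' P.final)
          c' (.run p x.1) x.2 := by
    intro x hx
    induction hx with
    | refl => exact ⟨c, .refl, hc⟩
    | @tail x y _ hxy ih =>
      obtain ⟨c', h₁, h₂⟩ := ih
      obtain ⟨s, hs, hy⟩ := hxy
      cases s with
      | move d =>
        obtain ⟨c'', h₃, h₄⟩ := h₂.silentReach (b := x.2.head) (o := some d) (s' := .run p y.1)
          (by simp) (by simp [trans, hs])
        refine ⟨c'', h₁.trans h₃, ?_⟩
        rw [Tape.write_self] at h₄
        rw [hy]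
        exact h₄
      | write b =>
        obtain ⟨c'', h₃, h₄⟩ := h₂.silentReach (b := b) (o := none) (s' := .run p y.1)
          (by simp) (by simp [trans, hs])
        refine ⟨c'', h₁.trans h₃, ?_⟩
        rw [hy]
        exact h₄
  obtain ⟨c₁, h₁, k₁⟩ := key _ hr
  obtain ⟨c₂, h₂, k₂⟩ := k₁.silentReach (b := t'.head) (o := some .right) (s' := .read p)
    (by simp) (by simp [trans, hl])
  rw [Tape.write_self] at k₂
  obtain ⟨c₃, h₃, k₃⟩ := k₂.silentReach (by simp) rfl
  refine ⟨c₃, (h₁.trans h₂).trans h₃, t', ht', ?_⟩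
  rw [Tape.write_self] at k₃
  have e : (t'.optMove (some .right)).optMove (some .left) = t' := Tape.move_right_left t'
  rw [e] at k₃
  have : decide (flag (t'.optMove (some .right)).head) = decide (b = 1) :=
    decide_eq_decide.2 (flag_of_storesList ht' hb)
  rwa [this] at k₃

theorem At.mem_final {e : P.Ready} {v : List ℕ} {c : P.machine.lts.State}
    (h : P.At (.inr e) v c) : c ∈ P.machine.lts.final ↔ e ∈ P.final := by
  obtain ⟨t, -, hc⟩ := h
  refine hc.mem_final.trans ?_
  simp [entry]

theorem At.exists_react_of_step {e : P.Ready} {v : List ℕ} {c c' : P.machine.lts.State}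
    {a : ActTau Act} (h : P.At (.inr e) v c) (hc : P.machine.lts.step c a c') :
    ∃ p, P.react e a = some p := by
  obtain ⟨t, -, h⟩ := h
  have := h.isSome_of_step hc
  rw [entry, trans, Option.isSome_map] at this
  exact Option.isSome_iff_exists.1 this

theorem At.exists_step {e : P.Ready} {v : List ℕ} {c : P.machine.lts.State}
    {a : ActTau Act} {p : P.Query} (h : P.At (.inr e) v c) (ha : P.react e a = some p) :
    ∃ c', P.machine.lts.step c a c' ∧
      ∃ c'', P.machine.lts.SilentReach c' c'' ∧ P.At (.inl p) v c'' := by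
  obtain ⟨t, ht, h⟩ := h
  obtain ⟨c', h₁, c'', h₂, h₃⟩ := h.exists_step (a := a) (b := t.head) (o := none)
    (s' := entry (.inl p)) (by simp [entry, trans, ha])
  refine ⟨c', h₁, c'', h₂, t, ht, ?_⟩
  rwa [Tape.write_self] at h₃

end ReactiveProgram

end ReactiveProgram

/-! ### Codes of finite sets and programs for partial recursive functions -/

section Codes

theorem testBit_finiteSetCode (X : Set ℕ) (hX : X.Finite) (x : ℕ) :
    (finiteSetCode X hX).testBit x = true ↔ x ∈ X := by
  rw [← Nat.mem_bitIndices, ← List.mem_toFinset, finiteSetCode,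
    Finset.toFinset_bitIndices_sum_two_pow, Set.Finite.mem_toFinset]

/-- `x` is the code of a pair with first component `c` in the finite set with code `K`. -/
def IsTransitionCode (c x K : ℕ) : Prop := K.testBit x = true ∧ x.unpair.1 = c

instance (c x K : ℕ) : Decidable (IsTransitionCode c x K) :=
  inferInstanceAs (Decidable (_ ∧ _))

theorem primrecRel_isTransitionCode (c : ℕ) : PrimrecRel (IsTransitionCode c) := by
  have hpow : Primrec₂ ((· ^ ·) : ℕ → ℕ → ℕ) := Primrec₂.unpaired'.1 Nat.Primrec.pow
  -- The bit test is expressed by arithmetic that is known to be primitive recursive.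
  have h₁ : PrimrecRel fun x K : ℕ => K / 2 ^ x % 2 = 1 :=
    Primrec.eq.comp (Primrec.nat_mod.comp (Primrec.nat_div.comp Primrec.snd
      (hpow.comp (Primrec.const 2) Primrec.fst)) (Primrec.const 2)) (Primrec.const 1)
  have h₂ : PrimrecRel fun x _ : ℕ => x.unpair.1 = c :=
    Primrec.eq.comp (Primrec.fst.comp (Primrec.unpair.comp Primrec.fst)) (Primrec.const c)
  refine (PrimrecPred.and h₁ h₂).of_eq fun ⟨x, K⟩ => ?_
  simp [IsTransitionCode, Nat.testBit_eq_decide_div_mod_eq]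

/-- Whether the finite set with code `K` contains a pair with first component `c`. -/
def enabledCode (c K : ℕ) : ℕ := if ∃ x < K, IsTransitionCode c x K then 1 else 0

theorem computable_enabledCode (c : ℕ) : Computable (enabledCode c) := by
  have h : PrimrecPred fun K : ℕ => ∃ x < K, IsTransitionCode c x K :=
    (primrecRel_isTransitionCode c).exists_lt.comp Primrec.id Primrec.id
  exact (Primrec.ite h (Primrec.const 1) (Primrec.const 0)).to_comp

theorem enabledCode_eq (c K : ℕ) [Decidable (∃ x, IsTransitionCode c x K)] :
    enabledCode c K = if ∃ x, IsTransitionCode c x K then 1 else 0 := by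
  have : (∃ x < K, IsTransitionCode c x K) ↔ ∃ x, IsTransitionCode c x K := by
    refine ⟨fun ⟨x, _, h⟩ => ⟨x, h⟩, fun ⟨x, h⟩ => ⟨x, ?_, h⟩⟩
    -- The bounded search misses nothing: if bit `x` of `K` is set, then `x < 2 ^ x ≤ K`.
    exact Nat.lt_two_pow_self.trans_le (Nat.ge_two_pow_of_testBit h.1)
  simp only [enabledCode, this]

/-- The second component of the least pair with first component `c` in the finite set with
code `K`. -/
def targetCode (c K : ℕ) : Part ℕ :=
  (Nat.rfind fun x => Part.some (decide (IsTransitionCode c x K))).map fun x => x.unpair.2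

theorem partrec_targetCode (c : ℕ) : Partrec (targetCode c) := by
  have h : Partrec₂ fun K x : ℕ => Part.some (decide (IsTransitionCode c x K)) :=
    ((primrecRel_isTransitionCode c).decide.comp Primrec.snd Primrec.fst).to_comp.partrec
  exact (Partrec.rfind h).map
    (Computable.snd.comp (Computable.unpair.comp Computable.snd))

/-- Existence makes the unbounded search terminate, and uniqueness, which determinism of `T` will
supply, makes its result the intended pair. -/
theorem mem_targetCode {c K m : ℕ} (hm : IsTransitionCode c (Nat.pair c m) K)
    (huniq : ∀ x, IsTransitionCode c x K → x = Nat.pair c m) : m ∈ targetCode c K := by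
  refine (Part.mem_map_iff _).2 ⟨Nat.pair c m, ?_, by simp⟩
  obtain ⟨x, hx, -⟩ := Nat.rfind_min' (p := fun x => decide (IsTransitionCode c x K))
    (m := Nat.pair c m) (by simpa using hm)
  have := Nat.rfind_spec hx
  rwa [← huniq x (by simpa using this)]

/-- A pair of partial recursive functions is evaluated by a code on the first entry of a list. -/
theorem exists_code_pair {f g : ℕ →. ℕ} (hf : Partrec f) (hg : Partrec g) :
    ∃ c : ToPartrec.Code, ∀ (v : List ℕ) (m b : ℕ), m ∈ f v.headI → b ∈ g v.headI →
      [m, b] ∈ c.eval v := by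
  obtain ⟨cf, hcf⟩ := ToPartrec.Code.exists_code (Nat.Partrec'.part_iff₁.2 hf)
  obtain ⟨cg, hcg⟩ := ToPartrec.Code.exists_code (Nat.Partrec'.part_iff₁.2 hg)
  -- Composing with `.head` feeds both codes the one-entry list `[v.headI]`, which is `[0]` when `v`
  -- is empty.
  refine ⟨(cf.cons cg).comp .head, fun v m b hm hb => ?_⟩
  have h₁ : cf.eval [v.headI] = pure <$> f v.headI := hcf ⟨[v.headI], rfl⟩
  have h₂ : cg.eval [v.headI] = pure <$> g v.headI := hcg ⟨[v.headI], rfl⟩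
  rw [Part.eq_some_iff.2 hm] at h₁
  rw [Part.eq_some_iff.2 hb] at h₂
  simp [h₁, h₂]

end Codes

/-! ### Executing a deterministic computable transition system -/

section Execution

variable {Act : Type u}

/-- The program executing a deterministic transition system whose actions are numbered by `e`. It
stores the code of the current state, asks the questions `0, …, k` about it, where question `0` is
finality and question `j + 1` is whether the action with number `j` is enabled, records the answers,
offers the enabled actions and computes the code of the next state. -/
def executionProgram {k : ℕ} (e : ActTau Act ≃ Fin k) (codeStart : ToPartrec.Code)
    (codeMove : Fin k → ToPartrec.Code) (codeAsk : Fin (k + 1) → ToPartrec.Code) :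
    ReactiveProgram Act where
  Query := Option (Fin k) ⊕ Fin (k + 1) × (Fin (k + 1) → Bool)
  Ready := Fin (k + 1) → Bool
  finite_query := inferInstance
  finite_ready := inferInstance
  code
    | .inl none => codeStart
    | .inl (some a) => codeMove a
    | .inr (i, _) => codeAsk i
  next
    | .inl _, _ => .inl (.inr (0, fun _ => false))
    | .inr (i, acc), b =>
      if h : i.1 + 1 < k + 1 then .inl (.inr (⟨i.1 + 1, h⟩, Function.update acc i b))
      else .inr (Function.update acc i b)
  start := .inl none
  react acc a :=
    -- Giving τ priority keeps the program deterministic on all Boolean vectors, including those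
    -- that describe no state of `T`.
    if acc (e a).succ = true ∧ (a.isSome → acc (e tau).succ = false) then some (.inl (some (e a)))
    else none
  final := {acc | acc 0 = true}
  deterministic := by
    intro acc a ha h
    obtain ⟨a, rfl⟩ := Option.ne_none_iff_exists'.1 ha
    have h' : acc (e tau).succ = true := by
      by_contra h'
      simp [h'] at h
    simp [h']

theorem exists_rtm_of_codes (T : TransitionSystem.{u, v} Act) (hdet : T.Deterministic) {k : ℕ}
    (e : ActTau Act ≃ Fin k) (code : T.State → ℕ) (truth : T.State → Fin (k + 1) → Bool)
    (hfinal : ∀ s, truth s 0 = true ↔ s ∈ T.final)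
    (henabled : ∀ s a, truth s (e a).succ = true ↔ ∃ t, T.step s a t)
    {codeStart : ToPartrec.Code} {codeMove : Fin k → ToPartrec.Code}
    {codeAsk : Fin (k + 1) → ToPartrec.Code}
    (hStart : [code T.init, 0] ∈ codeStart.eval [])
    (hMove : ∀ s a t j, T.step s a t → [code t, 0] ∈ (codeMove (e a)).eval [code s, j])
    (hAsk : ∀ s i j, [code s, (truth s i).toNat] ∈ (codeAsk i).eval [code s, j]) :
    ∃ M : RTM.{u, 0, 0} Act StackSymbol, M.Deterministic ∧ DivPresBranchingBisimilar M.lts T := by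
  let P := executionProgram e codeStart codeMove codeAsk
  -- The entry `j` is a leftover answer; every code reads only the first entry through the
  -- hypotheses on `[code s, j]`, which hold for all `j`.
  let D : P.machine.lts.State → T.State → Prop := fun c s =>
    ∃ j, P.At (.inr (truth s)) [code s, j] c
  -- Induction on the number `n` of questions left after question `i`; the invariant is that all
  -- earlier answers in `acc` are correct.
  have ask : ∀ n (i : Fin (k + 1)) (acc : Fin (k + 1) → Bool) (s : T.State) (j : ℕ)
      (c : P.machine.lts.State), k - i.1 = n → (∀ i' < i, acc i' = truth s i') →
      P.At (.inl (.inr (i, acc))) [code s, j] c →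
      ∃ d, P.machine.lts.SilentReach c d ∧ D d s := by
    intro n
    induction n with
    | zero =>
      intro i acc s j c hi hacc hc
      obtain ⟨d, h₁, h₂⟩ := hc.exists_silentReach (hAsk s i j) (by cases truth s i <;> simp)
      refine ⟨d, h₁, (truth s i).toNat, ?_⟩
      have hn : ¬ i.1 + 1 < k + 1 := by omega
      have hu : Function.update acc i (truth s i) = truth s := by
        funext i'
        rcases eq_or_ne i' i with rfl | hne
        · simp
        · rw [Function.update_of_ne hne]
          exact hacc _ (by omega)
      simpa [P, executionProgram, hn, hu] using h₂
    | succ n ih =>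
      intro i acc s j c hi hacc hc
      obtain ⟨d, h₁, h₂⟩ := hc.exists_silentReach (hAsk s i j) (by cases truth s i <;> simp)
      have hn : i.1 + 1 < k + 1 := by omega
      obtain ⟨d', h₃, h₄⟩ := ih ⟨i.1 + 1, hn⟩ (Function.update acc i (truth s i)) s
        (truth s i).toNat d (by simp; omega)
        (by
          intro i' hi'
          rcases eq_or_ne i' i with rfl | hne
          · simp
          · rw [Function.update_of_ne hne]
            refine hacc _ ?_
            have : i'.1 < i.1 + 1 := hi'
            omega)
        (by simpa [P, executionProgram, hn] using h₂)
      exact ⟨d', h₁.trans h₃, h₄⟩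
  have settle : ∀ (q : Option (Fin k)) (w : List ℕ) (s : T.State) (c : P.machine.lts.State),
      P.At (.inl (.inl q)) w c → [code s, 0] ∈ (P.code (.inl q)).eval w →
      ∃ d, P.machine.lts.SilentReach c d ∧ D d s := by
    intro q w s c hc hw
    obtain ⟨c', h₁, h₂⟩ := hc.exists_silentReach hw (.inl rfl)
    obtain ⟨d, h₃, h₄⟩ := ask _ 0 (fun _ => false) s 0 c' rfl
      (fun i hi => absurd hi (Fin.not_lt_zero i)) h₂
    exact ⟨d, h₁.trans h₃, h₄⟩
  have hreact : ∀ s a, (∃ t, T.step s a t) →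
      P.react (truth s) a = some (.inl (some (e a))) := by
    intro s a h
    have h' : truth s (e a).succ = true ∧ (a.isSome → truth s (e tau).succ = false) := by
      refine ⟨(henabled s a).2 h, fun ha => ?_⟩
      by_contra hτ
      obtain ⟨t, ht⟩ := (henabled s tau).1 (by simpa using hτ)
      obtain ⟨t', ht'⟩ := h
      exact hdet.2 _ _ ht ⟨a, t', Option.isSome_iff_ne_none.1 ha, ht'⟩
    exact if_pos h'
  have hback : ∀ d s, D d s → ∀ a t, T.step s a t →
      ∃ c, P.machine.lts.step d a c ∧ ∃ d', P.machine.lts.SilentReach c d' ∧ D d' t := by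
    rintro d s ⟨j, hd⟩ a t ht
    obtain ⟨c, h₁, c', h₂, h₃⟩ := hd.exists_step (hreact s a ⟨t, ht⟩)
    obtain ⟨d', h₄, h₅⟩ := settle _ _ t _ h₃ (hMove s a t j ht)
    exact ⟨c, h₁, d', h₂.trans h₄, h₅⟩
  refine ⟨P.machine, P.machine_deterministic, .of_silentReach _ _ P.machine_deterministic.lts D
    ?_ ?_ ?_ hback⟩
  · obtain ⟨c, h₁, h₂⟩ := P.exists_silentReach_init
    obtain ⟨d, h₃, h₄⟩ := settle none [] T.init c h₂ hStart
    exact ⟨d, h₁.trans h₃, h₄⟩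
  · rintro d s ⟨j, hd⟩
    exact hd.mem_final.trans (hfinal s)
  · rintro d s hD a c hc
    obtain ⟨j, hd⟩ := id hD
    obtain ⟨p, hp⟩ := hd.exists_react_of_step hc
    have ha : truth s (e a).succ = true := by
      by_contra ha
      have : P.react (truth s) a = none := if_neg fun h => ha h.1
      rw [this] at hp
      cases hp
    obtain ⟨t, ht⟩ := (henabled s a).1 ha
    obtain ⟨c', hc', h⟩ := hback _ _ hD _ _ ht
    -- The given step and the one simulating `T` coincide by determinism, so this direction follows
    -- from `hback`.
    obtain rfl := P.machine_deterministic.lts.1 _ _ _ _ hc hc'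
    exact ⟨t, ht, h⟩

end Execution

/-! ### Codes for the queries about a computable transition system -/

theorem mainTheorem9 {Act : Type u} [Finite Act] (T : TransitionSystem.{u, v} Act)
    (hdet : T.Deterministic) (hcomp : T.IsComputable) :
    ∃ (Data : Type) (_ : Finite Data) (M : RTM.{u, 0, 0} Act Data),
      M.Deterministic ∧ DivPresBranchingBisimilar M.lts T := by
  classical
  obtain ⟨hT, codeAct, code, hAct, hcode, ⟨fo, hfo, hfo', -⟩, ⟨ff, hff, hff', -⟩⟩ := hcomp
  obtain ⟨k, ⟨e⟩⟩ := Finite.exists_equiv_fin (ActTau Act)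
  have htrans : ∀ s a x, IsTransitionCode (codeAct a) x (T.outCode hT codeAct code s) ↔
      ∃ t, T.step s a t ∧ x = Nat.pair (codeAct a) (code t) := by
    intro s a x
    rw [IsTransitionCode, TransitionSystem.outCode, testBit_finiteSetCode]
    constructor
    · rintro ⟨⟨⟨b, t⟩, hbt, rfl⟩, hx⟩
      simp only [Nat.unpair_pair] at hx
      -- Injectivity of the action coding recovers the action from the first component.
      obtain rfl := hAct hx
      exact ⟨t, hbt, rfl⟩
    · rintro ⟨t, ht, rfl⟩
      exact ⟨⟨(a, t), ht, rfl⟩, by simp⟩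
  have hfo₁ := Partrec.nat_iff.2 hfo
  have hff₁ := Partrec.nat_iff.2 hff
  have hid : Partrec fun n : ℕ => Part.some n := Computable.id.partrec
  have hzero : Partrec fun _ : ℕ => Part.some 0 := (Computable.const 0).partrec
  obtain ⟨codeStart, hStart⟩ := exists_code_pair
    (f := fun _ => Part.some (code T.init)) (Computable.const _).partrec hzero
  -- The constant second entry `0` gives the result the form `[m, b]` that every query must produce.
  have hMove (a : Fin k) := exists_code_pair
    (hfo₁.bind ((partrec_targetCode (codeAct (e.symm a))).comp Computable.snd).to₂) hzero
  have hAsk (a : Fin k) := exists_code_pair hid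
    (hfo₁.map ((computable_enabledCode (codeAct (e.symm a))).comp Computable.snd).to₂)
  choose codeMove hMove using hMove
  choose codeAsk hAsk using hAsk
  obtain ⟨codeFinal, hFinal⟩ := exists_code_pair hid hff₁
  refine ⟨StackSymbol, inferInstance, exists_rtm_of_codes T hdet e code
    (fun s => Fin.cons (decide (s ∈ T.final)) fun a => decide (∃ t, T.step s (e.symm a) t))
    (by simp) (by simp) (codeStart := codeStart) (codeMove := codeMove)
    (codeAsk := Fin.cons codeFinal codeAsk) ?_ ?_ ?_⟩
  · exact hStart _ _ _ (Part.mem_some _) (Part.mem_some _)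
  · intro s a t j ht
    refine hMove _ _ _ _ ?_ (Part.mem_some _)
    refine Part.mem_bind_iff.2 ⟨_, (hfo' s).symm ▸ Part.mem_some _, ?_⟩
    rw [Equiv.symm_apply_apply]
    refine mem_targetCode ((htrans s a _).2 ⟨t, ht, rfl⟩) fun x hx => ?_
    obtain ⟨t', ht', rfl⟩ := (htrans s a _).1 hx
    rw [hdet.1 _ _ _ _ ht ht']
  · intro s i j
    refine Fin.cases ?_ (fun a => ?_) i
    · refine hFinal _ _ _ (Part.mem_some _) ?_
      simp only [List.headI_cons, hff', Part.mem_some_iff, TransitionSystem.fin, Fin.cons_zero]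
      by_cases h : s ∈ T.final <;> simp [h]
    · refine hAsk _ _ _ _ (Part.mem_some _) ?_
      refine (Part.mem_map_iff _).2 ⟨_, (hfo' s).symm ▸ Part.mem_some _, ?_⟩
      have : (∃ x, IsTransitionCode (codeAct (e.symm a)) x (T.outCode hT codeAct code s)) ↔
          ∃ t, T.step s (e.symm a) t := by
        simp only [htrans]
        exact ⟨fun ⟨_, t, ht, _⟩ => ⟨t, ht⟩, fun ⟨t, ht⟩ => ⟨_, t, ht, rfl⟩⟩
      rw [enabledCode_eq]
      simp only [this, Fin.cons_succ]
      by_cases h : ∃ t, T.step s (e.symm a) t <;> simp [h]
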